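/- Consider a set $N=\{1,\dots,n\}$ of agents ($n\ge 1$), a set $M$ of $m\ge 1$ indivisible chores, a finite list $\mathcal G=(G_1,\dots,G_g)$ of protected groups $G_k\subseteq N$, and additive costs $v_i(B)=\sum_{e\in B}v_i(e)\ge 0$ for $i\in N$, $B\subseteq M$. Assume that valuations are uniform, i.e. $v_i(e)=1$ for all $i\in N$, $e\in M$, and that $\mathcal G$ is laminar, i.e. any two of its groups are disjoint or one contains the other. An allocation $A$ partitions $M$ into bundles $(A_i)_{i\in N}$ (every chore is given to exactly one agent). For $G\subseteq N$ let $c_G(A)=\sum_{i\in G}v_i(A_i)$ be the cost of $G$ under $A$, let $v_G(B)=\sum_{e\in B}\min_{i\in G}v_i(e)$ (with $v_\emptyset=0$), let the proportional share be $PS(G)=\frac{|G|}{n}v_G(M)$, and let the anyprice share be $$APS(G)=\max_{p}\ \min_{B}\Big\{v_G(B): B\subseteq M,\ \sum_{e\in B}p_e\ge \tfrac{|G|}{n}\Big\},$$ where the maximum is over all price vectors $p\in\mathbb R_{\ge 0}^M$ with $\sum_{e\in M}p_e=1$. (1) For every such instance there is an allocation $A$ with $c_G(A)\le APS(G)$ for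 every $G\in\mathcal G$. (2) There is a randomized algorithm which, given $n$, $m$ and the membership table of $G_1,\dots,G_g$, runs in time polynomial in $n$, $m$ and $g$, and for every such instance always (for every outcome of its random choices) outputs an allocation $A$ with $c_G(A)\le APS(G)$ for every $G\in\mathcal G$, while $\mathbb E[c_G(A)]\le PS(G)$ for every $G\in\mathcal G$. Here an algorithm is a program for a random access machine over natural numbers with constants, indirect addressing, addition, truncated subtraction, branching and loops on whether a value is zero, and an instruction that draws a uniformly random integer from $\{0,\dots,k\}$ for a computed number $k$; the running time is the number of steps in the worst case. -/

import Mathlib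

/-! ### Allocation of indivisible chores with protected groups -/

/-- An instance of chores allocation with protected groups: agents `Fin n`, chores `Fin m`,
nonnegative costs `v i e` (extended additively to bundles), and a reference family of `g`
protected groups of agents. -/
structure ChoresInstance (n m : ℕ) where
  v : Fin n → Fin m → ℝ
  v_nonneg : ∀ i e, 0 ≤ v i e
  g : ℕ
  group : Fin g → Finset (Fin n)

/-- An integral allocation of chores, every chore being given to exactly one agent:
`A e` is the agent who receives `e`. -/
abbrev ChoresAllocation (n m : ℕ) : Type := Fin m → Fin n

/-- The bundle that agent `i` receives. -/
def ChoresAllocation.bundle {n m : ℕ} (A : ChoresAllocation n m) (i : Fin n) : Finset (Fin m) :=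
  Finset.univ.filter fun e => A e = i

namespace ChoresInstance

variable {n m : ℕ} (I : ChoresInstance n m)

/-- Uniform valuations: every chore costs every agent `1`. -/
def Uniform : Prop := ∀ i e, I.v i e = 1

/-- Any two protected groups are disjoint or nested. -/
def Laminar : Prop :=
  ∀ k l, Disjoint (I.group k) (I.group l) ∨ I.group k ⊆ I.group l ∨ I.group l ⊆ I.group k

/-- The total cost that the members of `G` incur under the allocation `A`. -/
noncomputable def cost (A : ChoresAllocation n m) (G : Finset (Fin n)) : ℝ :=
  ∑ i ∈ G, ∑ e ∈ A.bundle i, I.v i e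

/-- The cost `min_{i ∈ G} v i e` of a chore to a group (`0` for the empty group). -/
noncomputable def groupVal (G : Finset (Fin n)) (e : Fin m) : ℝ :=
  ⨅ i : G, I.v i e

/-- The additive extension of `groupVal` to bundles. -/
noncomputable def groupBundleVal (G : Finset (Fin n)) (B : Finset (Fin m)) : ℝ :=
  ∑ e ∈ B, I.groupVal G e

/-- The proportional share `|G| / n * v_G(M)`. -/
noncomputable def PS (G : Finset (Fin n)) : ℝ :=
  (G.card : ℝ) / n * I.groupBundleVal G Finset.univ

/-- The least cost to `G` of a bundle whose total price is at least `|G| / n`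
(a minimum over a finite set of bundles, which contains the bundle of all chores). -/
noncomputable def minBundleVal (G : Finset (Fin n)) (p : Fin m → ℝ) : ℝ :=
  sInf {x | ∃ B : Finset (Fin m), (G.card : ℝ) / n ≤ ∑ e ∈ B, p e ∧ x = I.groupBundleVal G B}

/-- The anyprice share for chores: the maximum of `minBundleVal` over all price vectors
`p ≥ 0` with `∑ e, p e = 1` (it is attained, since only finitely many values occur). -/
noncomputable def APS (G : Finset (Fin n)) : ℝ :=
  sSup {y | ∃ p ∈ stdSimplex ℝ (Fin m), y = I.minBundleVal G p}

end ChoresInstance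

/-! ### Randomized random access machines -/

/-- The memory consists of arrays of natural numbers: `s a i` is entry `i` of array `a`. -/
abbrev RamMem : Type := ℕ → ℕ → ℕ

/-- Expressions: constants, (indirect) memory access, addition, truncated subtraction. -/
inductive RamExpr : Type
  | const (c : ℕ) : RamExpr
  | read (a : ℕ) (i : RamExpr) : RamExpr
  | add (x y : RamExpr) : RamExpr
  | sub (x y : RamExpr) : RamExpr

/-- The value of an expression. -/
def RamExpr.eval (s : RamMem) : RamExpr → ℕ
  | .const c => c
  | .read a i => s a (i.eval s)
  | .add x y => x.eval s + y.eval s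
  | .sub x y => x.eval s - y.eval s

/-- Programs. `write a i e` stores the value of `e` in entry `i` of array `a`; `draw a i e`
stores there a fresh integer, uniformly random in `{0, …, e}`. The conditions of `ite` and
`loop` hold when their value is nonzero. -/
inductive RamProg : Type
  | skip : RamProg
  | write (a : ℕ) (i e : RamExpr) : RamProg
  | draw (a : ℕ) (i e : RamExpr) : RamProg
  | seq (P Q : RamProg) : RamProg
  | ite (b : RamExpr) (P Q : RamProg) : RamProg
  | loop (b : RamExpr) (P : RamProg) : RamProg

/-- The memory after storing `x` in entry `i` of array `a`. -/
def RamMem.store (s : RamMem) (a i x : ℕ) : RamMem :=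
  fun a' i' => if a' = a ∧ i' = i then x else s a' i'

/-- A configuration: the programs still to be executed, in order, and the memory. The machine
has halted when nothing is left to be executed. -/
abbrev RamConfig : Type := List RamProg × RamMem

/-- The distribution of the configuration after one step. A step costs one unit of time; since
sums and differences are the only arithmetic, a number stored after `t` steps has `O(t)` more
bits than the numbers of the input, so the unit cost is polynomially related to bit cost. -/
noncomputable def RamConfig.step : RamConfig → PMF RamConfig
  | ([], s) => PMF.pure ([], s)
  | (.skip :: K, s) => PMF.pure (K, s)
  | (.write a i e :: K, s) => PMF.pure (K, s.store a (i.eval s) (e.eval s))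
  | (.draw a i e :: K, s) =>
      (PMF.uniformOfFintype (Fin (e.eval s + 1))).map fun x : Fin (e.eval s + 1) =>
        (K, s.store a (i.eval s) x.val)
  | (.seq P Q :: K, s) => PMF.pure (P :: Q :: K, s)
  | (.ite b P Q :: K, s) => PMF.pure ((if b.eval s = 0 then Q else P) :: K, s)
  | (.loop b P :: K, s) => PMF.pure (if b.eval s = 0 then K else P :: .loop b P :: K, s)

/-- The distribution of the configuration after `t` steps. -/
noncomputable def RamConfig.run : ℕ → RamConfig → PMF RamConfig
  | 0, c => PMF.pure c
  | t + 1, c => c.step.bind (RamConfig.run t)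

namespace ChoresInstance

variable {n m : ℕ} (I : ChoresInstance n m)

open Classical in
/-- The input of an algorithm for uniform valuations. Array `0` holds `n`, `m`, `g`; array `1`
holds the `g × n` membership table of the groups, row by row; all other entries are `0`. -/
noncomputable def input : RamMem
  | 0, 0 => n
  | 0, 1 => m
  | 0, 2 => I.g
  | 1, j => if ∃ (k : Fin I.g) (i : Fin n), j = k * n + i ∧ i ∈ I.group k then 1 else 0
  | _, _ => 0

/-- The output of a machine: if it has halted and the first `m` entries of array `2` are
(indices of) agents, then entry `e` is the agent who receives chore `e`. -/
def output (n m : ℕ) (c : RamConfig) : Option (ChoresAllocation n m) :=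
  if h : c.1.length = 0 ∧ ∀ e : Fin m, c.2 2 e < n then some fun e => ⟨c.2 2 e, h.2 e⟩ else none

/-- The distribution of the output of `P` on the instance `I` after `t` steps
(`none`: the machine has not halted or has not produced an allocation). -/
noncomputable def outputDist (P : RamProg) (t : ℕ) : PMF (Option (ChoresAllocation n m)) :=
  (RamConfig.run t ([P], I.input)).map (output n m)

/-- The expected cost of `G` under a random allocation. -/
noncomputable def expectedCost (μ : PMF (Option (ChoresAllocation n m)))
    (G : Finset (Fin n)) : ℝ :=
  ∑ A : ChoresAllocation n m, (μ (some A)).toReal * I.cost A G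

end ChoresInstance

/-!
Under uniform valuations the cost of a group is the number of chores that its members receive, and
its anyprice share is at least `⌈|G| * m / n⌉` for a nonempty group `G`, by equal prices
(`ChoresInstance.Uniform.le_APS`).

The agents can be seated around a circle in such a way that every group of a laminar family
occupies consecutive seats. Each agent gets a key, whose leading binary digits record its membership
in the groups, the larger groups first; the members of a group then have the same digits for all
larger groups, since those contain the group or are disjoint from it. So the group is convex in the
order of the keys (`KeyOrder.addDigit`), and the positions of its members differ by less than its
size (`KeyOrder.keyRank_sub_lt`).

Distribute the chores evenly around the circle: chore `e` goes to the agent who sits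
`⌊e * n / m⌋` seats after a uniformly random seat `x`. Consecutive seats, `L` in number, then
receive fewer than `L * m / n + 1` chores, whatever `x` is
(`ChoresInstance.card_filter_mem_mul_lt`), which is the bound by the anyprice share. Every chore
goes to a uniformly random agent, so the expected cost of a group is its proportional share
(`ChoresInstance.sum_card_filter_mem`).

This is implemented by counting loops, with one random draw. A Hoare logic with time bounds, whose
main rule is `RamProg.Triple.forLoop`, proves the deterministic parts before and after the draw
correct. All loops run at most `n + m + g + 1` times, which makes the time bound a polynomial.
The existence of an allocation follows, since the output distribution has nonempty support.
-/

/-! ### Running times and a Hoare logic for deterministic machine code -/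

namespace RamMem

theorem store_apply (s : RamMem) (a i x a' : ℕ) :
    s.store a i x a' = if a' = a then Function.update (s a') i x else s a' := by
  funext i'
  by_cases h : a' = a <;> by_cases h' : i' = i <;> simp [store, h, h', Function.update]

end RamMem

namespace RamProg

/-- Started in memory `s`, the program `P` finishes after exactly `t` steps, in memory `s'`,
without drawing random numbers, whatever is left to be executed afterwards. -/
def Runs (P : RamProg) (s s' : RamMem) (t : ℕ) : Prop :=
  ∀ K u, RamConfig.run (t + u) (P :: K, s) = RamConfig.run u (K, s')

/-- A Hoare triple with a time bound: from every memory that satisfies `Pre`, the program `P`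
reaches deterministically, within `T` steps, a memory that satisfies `Post`. -/
def Triple (Pre : RamMem → Prop) (P : RamProg) (Post : RamMem → Prop) (T : ℕ) : Prop :=
  ∀ s, Pre s → ∃ s' t, t ≤ T ∧ P.Runs s s' t ∧ Post s'

theorem run_succ_of_step {c d : RamConfig} (h : c.step = PMF.pure d) (u : ℕ) :
    RamConfig.run (1 + u) c = RamConfig.run u d := by
  rw [add_comm, RamConfig.run, h, PMF.pure_bind]

theorem run_halted (u : ℕ) (s : RamMem) : RamConfig.run u ([], s) = PMF.pure ([], s) := by
  induction u with
  | zero => rfl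
  | succ u ih => rw [add_comm, run_succ_of_step rfl, ih]

theorem Runs.run_eq_pure {P : RamProg} {s s' : RamMem} {t T : ℕ} (h : P.Runs s s' t)
    (hT : t ≤ T) : RamConfig.run T ([P], s) = PMF.pure ([], s') := by
  obtain ⟨u, rfl⟩ := Nat.exists_eq_add_of_le hT
  rw [h, run_halted]

theorem runs_skip (s : RamMem) : skip.Runs s s 1 := fun _ u => run_succ_of_step rfl u

theorem runs_write (a : ℕ) (i e : RamExpr) (s : RamMem) :
    (write a i e).Runs s (s.store a (i.eval s) (e.eval s)) 1 := fun _ u => run_succ_of_step rfl u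

theorem Runs.seq {P Q : RamProg} {s s' s'' : RamMem} {t u : ℕ} (hP : P.Runs s s' t)
    (hQ : Q.Runs s' s'' u) : (seq P Q).Runs s s'' (1 + (t + u)) := fun K v => by
  rw [add_assoc, run_succ_of_step (d := (P :: Q :: K, s)) rfl, add_assoc, hP, hQ]

theorem Runs.loop {b : RamExpr} {P : RamProg} {s s' s'' : RamMem} {t u : ℕ} (hb : b.eval s ≠ 0)
    (hP : P.Runs s s' t) (hQ : (loop b P).Runs s' s'' u) :
    (loop b P).Runs s s'' (1 + (t + u)) := fun K v => by
  rw [add_assoc, run_succ_of_step (d := (P :: .loop b P :: K, s)) (by simp [RamConfig.step, hb]),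
    add_assoc, hP, hQ]

theorem runs_loop_zero {b : RamExpr} {P : RamProg} {s : RamMem} (hb : b.eval s = 0) :
    (loop b P).Runs s s 1 := fun K v => by
  rw [run_succ_of_step (d := (K, s)) (by simp [RamConfig.step, hb])]

theorem Triple.mono {Pre Pre' Post Post' : RamMem → Prop} {P : RamProg} {T T' : ℕ}
    (h : P.Triple Pre Post T) (hpre : ∀ s, Pre' s → Pre s) (hpost : ∀ s, Post s → Post' s)
    (hT : T ≤ T') : P.Triple Pre' Post' T' := fun s hs => by
  obtain ⟨s', t, ht, hr, hp⟩ := h s (hpre s hs)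
  exact ⟨s', t, ht.trans hT, hr, hpost s' hp⟩

theorem triple_skip {Pre Post : RamMem → Prop} (h : ∀ s, Pre s → Post s) :
    skip.Triple Pre Post 1 := fun s hs => ⟨s, 1, le_rfl, runs_skip s, h s hs⟩

theorem triple_write {Pre Post : RamMem → Prop} {a : ℕ} {i e : RamExpr}
    (h : ∀ s, Pre s → Post (s.store a (i.eval s) (e.eval s))) :
    (write a i e).Triple Pre Post 1 := fun s hs => ⟨_, 1, le_rfl, runs_write a i e s, h s hs⟩

theorem Triple.seq {Pre Mid Post : RamMem → Prop} {P Q : RamProg} {T U : ℕ}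
    (hP : P.Triple Pre Mid T) (hQ : Q.Triple Mid Post U) :
    (seq P Q).Triple Pre Post (1 + (T + U)) := fun s hs => by
  obtain ⟨s', t, ht, hr, hp⟩ := hP s hs
  obtain ⟨s'', u, hu, hr', hp'⟩ := hQ s' hp
  exact ⟨s'', _, by omega, hr.seq hr', hp'⟩

theorem Triple.ite {Pre Post : RamMem → Prop} {b : RamExpr} {P Q : RamProg} {T U : ℕ}
    (hP : P.Triple (fun s => Pre s ∧ b.eval s ≠ 0) Post T)
    (hQ : Q.Triple (fun s => Pre s ∧ b.eval s = 0) Post U) :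
    (ite b P Q).Triple Pre Post (1 + (T + U)) := fun s hs => by
  by_cases hb : b.eval s = 0
  · obtain ⟨s', t, ht, hr, hp⟩ := hQ s ⟨hs, hb⟩
    refine ⟨s', 1 + t, by omega, fun K u => ?_, hp⟩
    rw [add_assoc, run_succ_of_step (d := (Q :: K, s)) (by simp [RamConfig.step, hb]), hr]
  · obtain ⟨s', t, ht, hr, hp⟩ := hP s ⟨hs, hb⟩
    refine ⟨s', 1 + t, by omega, fun K u => ?_, hp⟩
    rw [add_assoc, run_succ_of_step (d := (P :: K, s)) (by simp [RamConfig.step, hb]), hr]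

/-- The scalar variable kept in entry `0` of array `a`. -/
abbrev var (a : ℕ) : RamExpr := .read a (.const 0)

/-- Assignment to a scalar variable. -/
abbrev assign (a : ℕ) (e : RamExpr) : RamProg := .write a (.const 0) e

/-- The counting loop `for v = 0, 1, …, bd - 1 do P`. -/
def forLoop (v : ℕ) (bd : RamExpr) (P : RamProg) : RamProg :=
  .seq (assign v (.const 0))
    (.loop (.sub bd (var v)) (.seq P (assign v (.add (var v) (.const 1)))))

/-- The invariant rule for counting loops: `I j` holds before the iteration with counter value
`j`. The invariant must not depend on the counter variable. `B` is any upper bound for the number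
`N` of iterations, which allows for uniform time bounds. -/
theorem Triple.forLoop {v N T B : ℕ} {bd : RamExpr} {P : RamProg} (I : ℕ → RamMem → Prop)
    (hB : N ≤ B) (hbd : ∀ j s, I j s → bd.eval s = N)
    (hI : ∀ j s x, I j s → I j (s.store v 0 x))
    (hP : ∀ j < N, P.Triple (fun s => I j s ∧ s v 0 = j) (fun s => I (j + 1) s ∧ s v 0 = j) T) :
    (forLoop v bd P).Triple (I 0) (I N) (B * (T + 3) + 3) := by
  have key : ∀ d j, j + d = N → ∀ s, I j s → s v 0 = j → ∃ s' t, t ≤ d * (T + 3) + 1 ∧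
      (RamProg.loop (.sub bd (var v)) (.seq P (assign v (.add (var v) (.const 1))))).Runs s s' t ∧
      I N s' := by
    intro d
    induction d with
    | zero =>
      intro j hj s hs hv
      obtain rfl : j = N := by omega
      exact ⟨s, 1, by omega, runs_loop_zero (by simp [RamExpr.eval, hbd _ s hs, hv]), hs⟩
    | succ d ih =>
      intro j hj s hs hv
      obtain ⟨s₁, t₁, ht₁, hr₁, hI₁, hv₁⟩ := hP j (by omega) s ⟨hs, hv⟩
      obtain ⟨s₂, t₂, ht₂, hr₂, hI₂⟩ := ih (j + 1) (by omega) (s₁.store v 0 (j + 1))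
        (hI _ _ _ hI₁) (by simp [RamMem.store])
      have hw := runs_write v (.const 0) (.add (var v) (.const 1)) s₁
      simp only [RamExpr.eval, hv₁] at hw
      have hb : (RamExpr.sub bd (var v)).eval s ≠ 0 := by
        simp only [RamExpr.eval, hbd _ s hs, hv]; omega
      refine ⟨s₂, _, ?_, Runs.loop hb (hr₁.seq hw) hr₂, hI₂⟩
      rw [add_one_mul]; omega
  intro s hs
  obtain ⟨s', t, ht, hr, hp⟩ := key N 0 (by omega) (s.store v 0 0) (hI _ _ _ hs)
    (by simp [RamMem.store])
  refine ⟨s', _, ?_, (runs_write v (.const 0) (.const 0) s).seq hr, hp⟩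
  have := Nat.mul_le_mul_right (T + 3) hB
  omega

/-- A program that draws a uniform number from `{0, …, k}` between two deterministic parts: its
final memory is a function of that number. -/
theorem run_seq_draw_seq {P Q : RamProg} {a : ℕ} {e : RamExpr} {s s₁ : RamMem} {k t T U : ℕ}
    (hP : P.Runs s s₁ t) (ht : t ≤ T) (hk : e.eval s₁ = k) (f : Fin (k + 1) → RamMem)
    (hQ : ∀ x : Fin (k + 1), ∃ u ≤ U, Q.Runs (s₁.store a 0 x) (f x) u) :
    RamConfig.run (T + U + 3) ([.seq P (.seq (.draw a (.const 0) e) Q)], s) =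
      (PMF.uniformOfFintype (Fin (k + 1))).map fun x => (([], f x) : RamConfig) := by
  subst hk
  obtain ⟨d, rfl⟩ := Nat.exists_eq_add_of_le ht
  rw [show t + d + U + 3 = 1 + (t + (1 + (1 + (d + U)))) by omega,
    run_succ_of_step (d := ([P, .seq (.draw a (.const 0) e) Q], s)) rfl, hP,
    run_succ_of_step (d := ([.draw a (.const 0) e, Q], s₁)) rfl, add_comm 1, RamConfig.run]
  simp only [RamConfig.step, PMF.bind_map]
  rw [← PMF.bind_pure_comp]
  congr 1
  funext x
  obtain ⟨u, hu, hr⟩ := hQ x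
  exact hr.run_eq_pure (by omega)

end RamProg

/-! ### Ordering the agents so that every group is contiguous -/

/-- The size of the group in row `k` of the membership table `M`, whose rows have length `n` and
are stored one after the other. -/
def rowSize (n : ℕ) (M : ℕ → ℕ) (k : ℕ) : ℕ :=
  ((Finset.range n).filter fun i => M (k * n + i) ≠ 0).card

/-- The first `g` rows of the membership table `M` describe a laminar family, in the form in which
sorting by size uses this: a group is disjoint from or contained in every group that is not
smaller. -/
def RowsLaminar (n g : ℕ) (M : ℕ → ℕ) : Prop :=
  ∀ k < g, ∀ l < g, rowSize n M k ≤ rowSize n M l →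
    (∀ i < n, M (k * n + i) ≠ 0 → M (l * n + i) = 0) ∨
      (∀ i < n, M (k * n + i) ≠ 0 → M (l * n + i) ≠ 0)

/-- The agents `i < n` have distinct keys `key i < w`, and every group whose row `k` satisfies `R`
is convex in the order of the keys. -/
structure KeyOrder (n : ℕ) (M : ℕ → ℕ) (R : ℕ → Prop) (key : ℕ → ℕ) (w : ℕ) : Prop where
  lt : ∀ i < n, key i < w
  inj : ∀ i < n, ∀ j < n, key i = key j → i = j
  convex : ∀ k, R k → ∀ i < n, ∀ j < n, ∀ l < n, M (k * n + i) ≠ 0 → M (k * n + l) ≠ 0 →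
    key i ≤ key j → key j ≤ key l → M (k * n + j) ≠ 0

theorem KeyOrder.mono {n : ℕ} {M : ℕ → ℕ} {R R' : ℕ → Prop} {key : ℕ → ℕ} {w : ℕ}
    (h : KeyOrder n M R key w) (hR : ∀ k, R' k → R k) : KeyOrder n M R' key w :=
  ⟨h.lt, h.inj, fun k hk => h.convex k (hR k hk)⟩

/-- The sorting step: a new leading binary digit of the keys makes the group `l` convex, and keeps
every group convex on which this digit is constant. -/
theorem KeyOrder.addDigit {n l : ℕ} {M : ℕ → ℕ} {R R' : ℕ → Prop} {key key' : ℕ → ℕ} {w : ℕ}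
    (h : KeyOrder n M R key w)
    (hkey : ∀ i < n, key' i = if M (l * n + i) ≠ 0 then key i + w else key i)
    (hR : ∀ k, R' k → k = l ∨ R k ∧ ((∀ i < n, M (k * n + i) ≠ 0 → M (l * n + i) = 0) ∨
      (∀ i < n, M (k * n + i) ≠ 0 → M (l * n + i) ≠ 0))) :
    KeyOrder n M R' key' (w + w) where
  lt i hi := by have := h.lt i hi; grind
  inj i hi j hj hij := by
    have := h.lt i hi
    have := h.lt j hj
    have := h.inj i hi j hj
    grind
  convex k hk i hi j hj l' hl hik hlk hij hjl := by
    have hi' := h.lt i hi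
    have hj' := h.lt j hj
    have hl' := h.lt l' hl
    rw [hkey i hi, hkey j hj] at hij
    rw [hkey j hj, hkey l' hl] at hjl
    rcases hR k hk with rfl | ⟨hk, hd⟩
    · grind
    · have hc := h.convex k hk i hi j hj l' hl hik hlk
      rcases hd with hd | hd
      · simp only [hd i hi hik, hd l' hl hlk] at hij hjl
        grind
      · have h1 := hd i hi hik
        have h2 := hd l' hl hlk
        grind

/-- The position of agent `i` in the order of the keys. -/
def keyRank (n : ℕ) (key : ℕ → ℕ) (i : ℕ) : ℕ :=
  ((Finset.range n).filter fun j => key j < key i).card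

theorem keyRank_lt {n : ℕ} (key : ℕ → ℕ) {i : ℕ} (hi : i < n) : keyRank n key i < n := by
  conv_rhs => rw [← Finset.card_range n]
  exact Finset.card_lt_card (Finset.filter_ssubset.2 ⟨i, by simpa using hi, lt_irrefl _⟩)

theorem KeyOrder.keyRank_inj {n : ℕ} {M : ℕ → ℕ} {R : ℕ → Prop} {key : ℕ → ℕ} {w : ℕ}
    (h : KeyOrder n M R key w) {i j : ℕ} (hi : i < n) (hj : j < n)
    (hij : keyRank n key i = keyRank n key j) : i = j := by
  have aux : ∀ i < n, ∀ j, keyRank n key i = keyRank n key j → key j ≤ key i := by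
    intro i hi j hij
    by_contra! hlt
    refine hij.not_lt (Finset.card_lt_card ⟨fun x => ?_, fun hsub => ?_⟩)
    · simp only [Finset.mem_filter]; exact fun hx => ⟨hx.1, hx.2.trans hlt⟩
    · have := hsub (Finset.mem_filter.2 ⟨Finset.mem_range.2 hi, hlt⟩)
      simp at this
  exact h.inj i hi j hj (le_antisymm (aux j hj i hij.symm) (aux i hi j hij))

/-- The positions of two members of a convex group differ by less than the size of the group. -/
theorem KeyOrder.keyRank_sub_lt {n : ℕ} {M : ℕ → ℕ} {R : ℕ → Prop} {key : ℕ → ℕ} {w k : ℕ}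
    (h : KeyOrder n M R key w) (hk : R k) {i j : ℕ} (hi : i < n) (hj : j < n)
    (hik : M (k * n + i) ≠ 0) (hjk : M (k * n + j) ≠ 0) :
    keyRank n key i < keyRank n key j + rowSize n M k := by
  have hsub : ((Finset.range n).filter fun l => key l < key i) ⊆
      ((Finset.range n).filter fun l => key l < key j) ∪
        ((Finset.range n).filter fun l => M (k * n + l) ≠ 0).erase i := by
    intro l
    simp only [Finset.mem_filter, Finset.mem_union, Finset.mem_erase, Finset.mem_range]
    rintro ⟨hl, hli⟩
    by_cases hlj : key l < key j
    · exact Or.inl ⟨hl, hlj⟩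
    · exact Or.inr ⟨by rintro rfl; exact lt_irrefl _ hli, hl,
        h.convex k hk j hj l hl i hi hjk hik (not_lt.1 hlj) hli.le⟩
  have hmem : i ∈ (Finset.range n).filter fun l => M (k * n + l) ≠ 0 := by simp [hi, hik]
  have h1 := (Finset.card_le_card hsub).trans (Finset.card_union_le _ _)
  have h2 := Finset.card_erase_lt_of_mem hmem
  simp only [keyRank, rowSize] at *
  omega

/-- The array `ord` lists the agents in the order of their keys, twice in a row. -/
def ListsTwice (n : ℕ) (key ord : ℕ → ℕ) : Prop :=
  ∀ i < n, ord (keyRank n key i) = i ∧ ord (keyRank n key i + n) = i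

/-- Two consecutive turns of the cyclic order: entry `r < 2 * n` is the agent at position
`r` modulo `n`. -/
theorem ListsTwice.spec {n : ℕ} {M : ℕ → ℕ} {R : ℕ → Prop} {key ord : ℕ → ℕ} {w : ℕ}
    (h : KeyOrder n M R key w) (ho : ListsTwice n key ord) {r : ℕ} (hr : r < n + n) :
    ord r < n ∧ ∃ t, keyRank n key (ord r) + n * t = r := by
  have hinj : Function.Injective fun i : Fin n => (⟨keyRank n key i, keyRank_lt key i.2⟩ : Fin n) :=
    fun i j hij => Fin.ext (h.keyRank_inj i.2 j.2 (Fin.mk.inj hij))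
  have hsurj : ∀ p < n, ∃ i < n, keyRank n key i = p := fun p hp => by
    obtain ⟨i, hi⟩ := (Finite.injective_iff_surjective.1 hinj) ⟨p, hp⟩
    exact ⟨i, i.2, Fin.mk.inj hi⟩
  rcases lt_or_ge r n with hrn | hrn
  · obtain ⟨i, hi, rfl⟩ := hsurj r hrn
    exact ⟨by rw [(ho i hi).1]; exact hi, 0, by rw [(ho i hi).1]; rfl⟩
  · obtain ⟨i, hi, hir⟩ := hsurj (r - n) (by omega)
    have hri : r = keyRank n key i + n := by omega
    subst hri
    exact ⟨by rw [(ho i hi).2]; exact hi, 1, by rw [(ho i hi).2, mul_one]⟩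

/-! ### The program

The input occupies the arrays `0` and `1`, and array `2` receives the output. Array `3` holds the
keys of the agents, and array `4` lists the agents in the order of their keys. The arrays from `5`
on are scalar variables. -/

namespace ChoresProgram

open RamProg

/-- The number `n` of agents, as the program reads it. -/
abbrev agents : RamExpr := .read 0 (.const 0)

/-- The number `m` of chores, as the program reads it. -/
abbrev chores : RamExpr := .read 0 (.const 1)

/-- The number `g` of groups, as the program reads it. -/
abbrev groups : RamExpr := .read 0 (.const 2)

/-- The entry of the membership table for agent `i` (variable `10`) and the group whose row
starts at variable `7`. -/
abbrev member : RamExpr := .read 1 (.add (var 7) (var 10))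

/-- Initially, agent `i` has key `i`, and the weight (variable `5`) of the next digit is `n`. -/
def initKeys : RamProg :=
  .seq (assign 5 agents) (forLoop 10 agents (.write 3 (var 10) (var 10)))

/-- Computes the size of the current group in variable `9`. -/
def countGroup : RamProg :=
  .seq (assign 9 (.const 0))
    (forLoop 10 agents (.ite member (assign 9 (.add (var 9) (.const 1))) .skip))

/-- Adds the current group as a leading digit to the keys. -/
def addDigit : RamProg :=
  .seq (forLoop 10 agents
      (.ite member (.write 3 (var 10) (.add (.read 3 (var 10)) (var 5))) .skip))
    (assign 5 (.add (var 5) (var 5)))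

/-- Adds the current group as a digit if its size is the value of variable `6`, that is, if both
truncated differences of the two numbers vanish, and proceeds to the next row of the membership
table. -/
def processGroup : RamProg :=
  .seq countGroup (.seq (.ite (.add (.sub (var 9) (var 6)) (.sub (var 6) (var 9))) .skip addDigit)
    (assign 7 (.add (var 7) agents)))

/-- Goes through the sizes `0, …, n` (variable `6`), and for each of them through the groups
(variable `8`). -/
def sortGroups : RamProg :=
  forLoop 6 (.add agents (.const 1)) (.seq (assign 7 (.const 0)) (forLoop 8 groups processGroup))

/-- Computes in variable `9` the position of the agent in variable `10`. -/
def countRank : RamProg :=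
  .seq (assign 9 (.const 0)) (forLoop 11 agents
    (.ite (.sub (.read 3 (var 10)) (.read 3 (var 11)))
      (assign 9 (.add (var 9) (.const 1))) .skip))

/-- Lists the agents twice in array `4`, in the order of their keys. -/
def listAgents : RamProg :=
  forLoop 10 agents (.seq countRank
    (.seq (.write 4 (var 9) (var 10)) (.write 4 (.add (var 9) agents) (var 10))))

/-- Adds `n` to variable `14` and divides by `m`, with the quotient added to variable `13`. Since
the remainder was less than `m` before, `n` conditional subtractions of `m` are enough. -/
def advance : RamProg :=
  .seq (assign 14 (.add (var 14) agents)) (forLoop 10 agents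
    (.ite (.sub (.add (var 14) (.const 1)) chores)
      (.seq (assign 14 (.sub (var 14) chores)) (assign 13 (.add (var 13) (.const 1)))) .skip))

/-- Gives chore `e` to the agent who is `⌊e * n / m⌋` positions after the position stored in
variable `12`. -/
def distribute : RamProg :=
  .seq (assign 13 (.const 0)) (.seq (assign 14 (.const 0))
    (forLoop 15 chores (.seq (.write 2 (var 15) (.read 4 (.add (var 12) (var 13)))) advance)))

/-- The deterministic first part. -/
def arrange : RamProg := .seq initKeys (.seq sortGroups listAgents)

/-- The algorithm: arrange the agents in a cyclic order in which the groups are contiguous, draw a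
random starting position, and distribute the chores evenly around the circle. -/
def program : RamProg :=
  .seq arrange (.seq (.draw 12 (.const 0) (.sub agents (.const 1))) distribute)

variable {n m g B : ℕ} {M : ℕ → ℕ}

/-- The memory contains the input: the three sizes in array `0`, the table `M` in array `1`. -/
def HasInput (n m g : ℕ) (M : ℕ → ℕ) (s : RamMem) : Prop :=
  s 0 0 = n ∧ s 0 1 = m ∧ s 0 2 = g ∧ s 1 = M

theorem initKeys_triple (hn : n ≤ B) :
    initKeys.Triple (HasInput n m g M)
      (fun s => HasInput n m g M s ∧ KeyOrder n M (fun _ => False) (s 3) (s 5 0))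
      (1 + (1 + (B * (1 + 3) + 3))) := by
  refine Triple.seq (Mid := fun s => HasInput n m g M s ∧ s 5 0 = n) (triple_write ?_) ?_
  · intro s hs
    obtain ⟨h1, h2, h3, h4⟩ := hs
    simp [HasInput, RamMem.store_apply, RamExpr.eval, h1, h2, h3, h4]
  · refine (Triple.forLoop (fun j s => HasInput n m g M s ∧ s 5 0 = n ∧ ∀ i < j, s 3 i = i)
      hn ?_ ?_ ?_).mono (fun s hs => ⟨hs.1, hs.2, by simp⟩) ?_ le_rfl
    · exact fun j s hs => hs.1.1
    · intro j s x hs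
      simpa [HasInput, RamMem.store_apply] using hs
    · intro j hj
      refine triple_write fun s hs => ?_
      obtain ⟨⟨h1, h2, h3⟩, h4⟩ := hs
      refine ⟨⟨by simpa [HasInput, RamMem.store_apply] using h1, by simpa [RamMem.store_apply], ?_⟩,
        by simpa [RamMem.store_apply]⟩
      intro i hi
      have := h3 i
      simp only [RamMem.store_apply, RamExpr.eval, h4]
      grind
    · rintro s ⟨h1, h2, h3⟩
      exact ⟨h1, fun i hi => by rw [h3 i hi, h2]; exact hi,
        fun i hi j hj => by rw [h3 i hi, h3 j hj]; exact id, fun _ h => h.elim⟩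

/-- What a subprogram may change: the memories `s` and `s₀` agree outside the arrays in `L`. -/
def Frame (L : List ℕ) (s₀ s : RamMem) : Prop := ∀ a, a ∉ L → s a = s₀ a

theorem Frame.refl (L : List ℕ) (s : RamMem) : Frame L s s := fun _ _ => rfl

theorem Frame.store {L : List ℕ} {s₀ s : RamMem} (h : Frame L s₀ s) {a : ℕ} (ha : a ∈ L)
    (i x : ℕ) : Frame L s₀ (s.store a i x) := fun a' ha' => by
  rw [RamMem.store_apply, if_neg (by rintro rfl; exact ha' ha), h a' ha']

theorem card_filter_range_succ (p : ℕ → Prop) [DecidablePred p] (j : ℕ) :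
    ((Finset.range (j + 1)).filter p).card =
      ((Finset.range j).filter p).card + if p j then 1 else 0 := by
  rw [Finset.range_add_one, Finset.filter_insert]
  split_ifs <;> simp

theorem countGroup_triple (hn : n ≤ B) (s₀ : RamMem) (h₀ : s₀ 0 0 = n) :
    countGroup.Triple (fun s => s = s₀)
      (fun s => Frame [9, 10] s₀ s ∧
        s 9 0 = ((Finset.range n).filter fun i => s₀ 1 (s₀ 7 0 + i) ≠ 0).card)
      (1 + (1 + (B * (1 + (1 + 1) + 3) + 3))) := by
  refine Triple.seq (Mid := fun s => Frame [9, 10] s₀ s ∧ s 9 0 = 0) (triple_write ?_) ?_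
  · rintro s rfl
    exact ⟨(Frame.refl _ _).store (by simp) _ _, by simp [RamMem.store_apply, RamExpr.eval]⟩
  · refine (Triple.forLoop (fun j s => Frame [9, 10] s₀ s ∧
        s 9 0 = ((Finset.range j).filter fun i => s₀ 1 (s₀ 7 0 + i) ≠ 0).card)
      hn ?_ ?_ ?_).mono (fun s hs => ⟨hs.1, by simp [hs.2]⟩) (fun s => id) le_rfl
    · rintro j s ⟨h1, -⟩
      simp [RamExpr.eval, h1 0 (by simp), h₀]
    · rintro j s x ⟨h1, h2⟩
      exact ⟨h1.store (by simp) _ _, by simpa [RamMem.store_apply] using h2⟩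
    · intro j hj
      refine Triple.ite (triple_write ?_) (triple_skip ?_)
      · rintro s ⟨⟨⟨h1, h2⟩, h3⟩, h4⟩
        simp only [RamExpr.eval, h3, h1 1 (by simp), h1 7 (by simp)] at h4
        refine ⟨⟨h1.store (by simp) _ _, ?_⟩, by simpa [RamMem.store_apply] using h3⟩
        simp [card_filter_range_succ, RamMem.store_apply, RamExpr.eval, h2, h4]
      · rintro s ⟨⟨⟨h1, h2⟩, h3⟩, h4⟩
        simp only [RamExpr.eval, h3, h1 1 (by simp), h1 7 (by simp)] at h4
        exact ⟨⟨h1, by simp [card_filter_range_succ, h2, h4]⟩, h3⟩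

theorem countRank_triple (hn : n ≤ B) (s₀ : RamMem) (h₀ : s₀ 0 0 = n) :
    countRank.Triple (fun s => s = s₀)
      (fun s => Frame [9, 11] s₀ s ∧ s 9 0 = keyRank n (s₀ 3) (s₀ 10 0))
      (1 + (1 + (B * (1 + (1 + 1) + 3) + 3))) := by
  refine Triple.seq (Mid := fun s => Frame [9, 11] s₀ s ∧ s 9 0 = 0) (triple_write ?_) ?_
  · rintro s rfl
    exact ⟨(Frame.refl _ _).store (by simp) _ _, by simp [RamMem.store_apply, RamExpr.eval]⟩
  · refine (Triple.forLoop (fun j s => Frame [9, 11] s₀ s ∧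
        s 9 0 = ((Finset.range j).filter fun j => s₀ 3 j < s₀ 3 (s₀ 10 0)).card)
      hn ?_ ?_ ?_).mono (fun s hs => ⟨hs.1, by simp [hs.2]⟩) (fun s => id) le_rfl
    · rintro j s ⟨h1, -⟩
      simp [RamExpr.eval, h1 0 (by simp), h₀]
    · rintro j s x ⟨h1, h2⟩
      exact ⟨h1.store (by simp) _ _, by simpa [RamMem.store_apply] using h2⟩
    · intro j hj
      refine Triple.ite (triple_write ?_) (triple_skip ?_)
      · rintro s ⟨⟨⟨h1, h2⟩, h3⟩, h4⟩
        simp only [RamExpr.eval, h3, h1 3 (by simp), h1 10 (by simp), ne_eq, Nat.sub_eq_zero_iff_le,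
          not_le] at h4
        refine ⟨⟨h1.store (by simp) _ _, ?_⟩, by simpa [RamMem.store_apply] using h3⟩
        simp [card_filter_range_succ, RamMem.store_apply, RamExpr.eval, h2, h4]
      · rintro s ⟨⟨⟨h1, h2⟩, h3⟩, h4⟩
        simp only [RamExpr.eval, h3, h1 3 (by simp), h1 10 (by simp), Nat.sub_eq_zero_iff_le] at h4
        exact ⟨⟨h1, by simp [card_filter_range_succ, h2, h4]⟩, h3⟩

theorem addDigit_triple (hn : n ≤ B) (s₀ : RamMem) (h₀ : s₀ 0 0 = n) :
    addDigit.Triple (fun s => s = s₀)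
      (fun s => Frame [3, 5, 10] s₀ s ∧ s 5 0 = s₀ 5 0 + s₀ 5 0 ∧
        ∀ i < n, s 3 i = if s₀ 1 (s₀ 7 0 + i) ≠ 0 then s₀ 3 i + s₀ 5 0 else s₀ 3 i)
      (1 + (B * (1 + (1 + 1) + 3) + 3 + 1)) := by
  refine Triple.seq (Mid := fun s => Frame [3, 5, 10] s₀ s ∧ s 5 0 = s₀ 5 0 ∧
      ∀ i < n, s 3 i = if s₀ 1 (s₀ 7 0 + i) ≠ 0 then s₀ 3 i + s₀ 5 0 else s₀ 3 i)
    ?_ (triple_write ?_)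
  · refine (Triple.forLoop (fun j s => Frame [3, 5, 10] s₀ s ∧ s 5 0 = s₀ 5 0 ∧
      ∀ i, s 3 i = if i < j ∧ s₀ 1 (s₀ 7 0 + i) ≠ 0 then s₀ 3 i + s₀ 5 0 else s₀ 3 i)
      hn ?_ ?_ ?_).mono ?_ ?_ le_rfl
    · rintro j s ⟨h1, -⟩
      simp [RamExpr.eval, h1 0 (by simp), h₀]
    · rintro j s x ⟨h1, h2⟩
      exact ⟨h1.store (by simp) _ _, by simpa [RamMem.store_apply] using h2⟩
    · intro j hj
      refine Triple.ite (triple_write ?_) (triple_skip ?_)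
      · rintro s ⟨⟨⟨h1, h2, h5⟩, h3⟩, h4⟩
        simp only [RamExpr.eval, h3, h1 1 (by simp), h1 7 (by simp)] at h4
        refine ⟨⟨h1.store (by simp) _ _, by simpa [RamMem.store_apply] using h2, fun i => ?_⟩,
          by simpa [RamMem.store_apply] using h3⟩
        have := h5 i
        simp only [RamMem.store_apply, RamExpr.eval, h2, h3]
        grind
      · rintro s ⟨⟨⟨h1, h2, h5⟩, h3⟩, h4⟩
        simp only [RamExpr.eval, h3, h1 1 (by simp), h1 7 (by simp)] at h4
        refine ⟨⟨h1, h2, fun i => ?_⟩, h3⟩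
        have := h5 i
        grind
    · rintro s rfl
      exact ⟨Frame.refl _ _, rfl, by simp⟩
    · rintro s ⟨h1, h2, h3⟩
      exact ⟨h1, h2, fun i hi => by simp [h3 i, hi]⟩
  · rintro s ⟨h1, h2, h3⟩
    exact ⟨h1.store (by simp) _ _, by simp [RamMem.store_apply, RamExpr.eval, h2],
      by simpa [RamMem.store_apply] using h3⟩

/-- The state of the sorting phase when the groups with row in `R` have been processed. -/
def Sorted (n m g : ℕ) (M : ℕ → ℕ) (R : ℕ → Prop) (s : RamMem) : Prop :=
  HasInput n m g M s ∧ KeyOrder n M R (s 3) (s 5 0)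

theorem HasInput.of_eq {s s' : RamMem} (h : HasInput n m g M s) (h0 : s' 0 = s 0)
    (h1 : s' 1 = s 1) : HasInput n m g M s' := by
  unfold HasInput; rw [h0, h1]; exact h

theorem HasInput.frame {s s' : RamMem} {L : List ℕ} (h : HasInput n m g M s) (hf : Frame L s s')
    (h0 : 0 ∉ L) (h1 : 1 ∉ L) : HasInput n m g M s' := h.of_eq (hf 0 h0) (hf 1 h1)

/-- The rows before row `k` in the order of the sorting phase, when it is dealing with size `z`. -/
def Before (n g : ℕ) (M : ℕ → ℕ) (z k k' : ℕ) : Prop :=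
  k' < g ∧ (rowSize n M k' < z ∨ rowSize n M k' = z ∧ k' < k)

theorem processGroup_triple (hn : n ≤ B) (hL : RowsLaminar n g M) {z k : ℕ} (hk : k < g) :
    processGroup.Triple
      (fun s => Sorted n m g M (Before n g M z k) s ∧ s 6 0 = z ∧ s 7 0 = k * n ∧ s 8 0 = k)
      (fun s => Sorted n m g M (Before n g M z (k + 1)) s ∧ s 6 0 = z ∧ s 7 0 = (k + 1) * n ∧
        s 8 0 = k)
      (20 * B + 30) := by
  intro s₀ h₀
  refine ((Triple.seq (countGroup_triple hn s₀ h₀.1.1.1) (Triple.seq (Mid := fun s =>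
      Sorted n m g M (Before n g M z (k + 1)) s ∧ s 6 0 = z ∧ s 7 0 = k * n ∧ s 8 0 = k)
    (Triple.ite (triple_skip ?_) (T := 1) (U := 1 + (B * (1 + (1 + 1) + 3) + 3 + 1)) ?_)
    (triple_write ?_))).mono (Pre' := fun s => s = s₀) (fun s => id) (fun s => id) ?_) s₀ rfl
  · rintro s ⟨⟨h1, h2⟩, h3⟩
    obtain ⟨⟨hin, hord⟩, hz, h7, h8⟩ := h₀
    rw [h7, hin.2.2.2] at h2
    change s 9 0 = rowSize n M k at h2
    simp only [RamExpr.eval, h1 6 (by simp), hz, h2] at h3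
    refine ⟨⟨hin.frame h1 (by simp) (by simp), ?_⟩, by rw [h1 6 (by simp), hz],
      by rw [h1 7 (by simp), h7], by rw [h1 8 (by simp), h8]⟩
    rw [h1 3 (by simp), h1 5 (by simp)]
    refine hord.mono ?_
    rintro k' ⟨hk', hlt | ⟨heq, hlt⟩⟩
    · exact ⟨hk', Or.inl hlt⟩
    · refine ⟨hk', Or.inr ⟨heq, ?_⟩⟩
      have : k' ≠ k := by rintro rfl; omega
      omega
  · rintro s ⟨⟨h1, h2⟩, h3⟩
    obtain ⟨⟨hin, hord⟩, hz, h7, h8⟩ := h₀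
    rw [h7, hin.2.2.2] at h2
    change s 9 0 = rowSize n M k at h2
    simp only [RamExpr.eval, h1 6 (by simp), hz, h2] at h3
    have hin' := hin.frame h1 (by simp) (by simp)
    refine (addDigit_triple hn s hin'.1).mono (Pre' := fun s' => s' = s) (fun s => id) ?_ le_rfl
      s rfl
    rintro s' ⟨f1, f2, f3⟩
    rw [hin'.2.2.2, h1 7 (by simp), h7, h1 3 (by simp), h1 5 (by simp)] at f3
    refine ⟨⟨hin'.frame f1 (by simp) (by simp), ?_⟩, by rw [f1 6 (by simp), h1 6 (by simp), hz],
      by rw [f1 7 (by simp), h1 7 (by simp), h7], by rw [f1 8 (by simp), h1 8 (by simp), h8]⟩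
    rw [f2, h1 5 (by simp)]
    refine hord.addDigit f3 ?_
    rintro k' ⟨hk', h⟩
    by_cases hkk : k' = k
    · exact Or.inl hkk
    · refine Or.inr ⟨⟨hk', by omega⟩, hL k' hk' k hk (by omega)⟩
  · rintro s ⟨⟨hin, hord⟩, hz, h7, h8⟩
    refine ⟨⟨hin.of_eq (by simp [RamMem.store_apply]) (by simp [RamMem.store_apply]), ?_⟩, ?_⟩
    · simpa [RamMem.store_apply] using hord
    · simp [RamMem.store_apply, RamExpr.eval, h7, hz, h8, hin.1, add_one_mul]
  · omega

theorem rowSize_le (n : ℕ) (M : ℕ → ℕ) (k : ℕ) : rowSize n M k ≤ n :=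
  (Finset.card_filter_le _ _).trans (Finset.card_range n).le

theorem sortGroups_triple (hn : n + 1 ≤ B) (hg : g ≤ B) (hL : RowsLaminar n g M) :
    sortGroups.Triple (Sorted n m g M fun _ => False) (Sorted n m g M fun k => k < g)
      (B * (1 + (1 + (B * (20 * B + 30 + 3) + 3)) + 3) + 3) := by
  refine (Triple.forLoop (fun z => Sorted n m g M (Before n g M z 0)) hn ?_ ?_ ?_).mono ?_ ?_ le_rfl
  · rintro j s ⟨h, -⟩
    simp [RamExpr.eval, h.1]
  · rintro j s x ⟨h1, h2⟩
    exact ⟨h1.of_eq (by simp [RamMem.store_apply]) (by simp [RamMem.store_apply]),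
      by simpa [RamMem.store_apply] using h2⟩
  · intro z hz
    refine Triple.seq (Mid := fun s => Sorted n m g M (Before n g M z 0) s ∧ s 6 0 = z ∧
      s 7 0 = 0 * n) (triple_write ?_) ?_
    · rintro s ⟨⟨h1, h2⟩, h3⟩
      exact ⟨⟨h1.of_eq (by simp [RamMem.store_apply]) (by simp [RamMem.store_apply]),
        by simpa [RamMem.store_apply] using h2⟩, by simpa [RamMem.store_apply] using h3,
        by simp [RamMem.store_apply, RamExpr.eval]⟩
    · refine (Triple.forLoop (fun k s => Sorted n m g M (Before n g M z k) s ∧ s 6 0 = z ∧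
        s 7 0 = k * n) hg ?_ ?_ ?_).mono (fun s => id) ?_ le_rfl
      · rintro j s ⟨⟨h, -⟩, -⟩
        simp [RamExpr.eval, h.2.2.1]
      · rintro j s x ⟨⟨h1, h2⟩, h3⟩
        exact ⟨⟨h1.of_eq (by simp [RamMem.store_apply]) (by simp [RamMem.store_apply]),
          by simpa [RamMem.store_apply] using h2⟩, by simpa [RamMem.store_apply] using h3⟩
      · intro k hk
        exact (processGroup_triple (by omega) hL hk).mono (fun s => by tauto)
          (fun s => by tauto) le_rfl
      · rintro s ⟨⟨h1, h2⟩, h3, -⟩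
        refine ⟨⟨h1, h2.mono ?_⟩, h3⟩
        rintro k ⟨hk, h | ⟨-, h⟩⟩
        · exact ⟨hk, by omega⟩
        · omega
  · rintro s ⟨h1, h2⟩
    refine ⟨h1, h2.mono ?_⟩
    rintro k ⟨-, h | ⟨-, h⟩⟩ <;> omega
  · rintro s ⟨h1, h2⟩
    exact ⟨h1, h2.mono fun k hk => ⟨hk, Or.inl (Nat.lt_succ_of_le (rowSize_le n M k))⟩⟩

theorem listAgents_triple (hn : n ≤ B) :
    listAgents.Triple (Sorted n m g M fun k => k < g)
      (fun s => Sorted n m g M (fun k => k < g) s ∧ ListsTwice n (s 3) (s 4))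
      (B * (1 + (1 + (1 + (B * (1 + (1 + 1) + 3) + 3)) + (1 + (1 + 1))) + 3) + 3) := by
  refine (Triple.forLoop (fun j s => Sorted n m g M (fun k => k < g) s ∧
    ∀ i < j, s 4 (keyRank n (s 3) i) = i ∧ s 4 (keyRank n (s 3) i + n) = i) hn ?_ ?_ ?_).mono
    (fun s hs => ⟨hs, by simp⟩) (fun s => id) le_rfl
  · rintro j s ⟨⟨h, -⟩, -⟩
    simp [RamExpr.eval, h.1]
  · rintro j s x ⟨⟨h1, h2⟩, h3⟩
    exact ⟨⟨h1.of_eq (by simp [RamMem.store_apply]) (by simp [RamMem.store_apply]),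
      by simpa [RamMem.store_apply] using h2⟩, by simpa [RamMem.store_apply] using h3⟩
  · intro j hj s₀ ⟨⟨⟨h1, h2⟩, h3⟩, h4⟩
    refine ((countRank_triple hn s₀ h1.1).seq (Triple.seq (Mid := fun s => Frame [4, 9, 11] s₀ s ∧
        s 9 0 = keyRank n (s₀ 3) j ∧ s 4 = Function.update (s₀ 4) (keyRank n (s₀ 3) j) j)
      (triple_write ?_) (triple_write ?_))) s₀ rfl
    · rintro s ⟨f1, f2⟩
      rw [h4] at f2
      refine ⟨Frame.store (fun a ha => f1 a ?_) (by simp) _ _, ?_, ?_⟩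
      · simp only [List.mem_cons, not_or] at ha ⊢; tauto
      · simpa [RamMem.store_apply] using f2
      · simp [RamMem.store_apply, RamExpr.eval, f2, f1 10, f1 4, h4]
    · rintro s ⟨f1, f2, f3⟩
      have e3 : s 3 = s₀ 3 := f1 3 (by simp)
      have e5 : s 5 = s₀ 5 := f1 5 (by simp)
      have e10 : s 10 = s₀ 10 := f1 10 (by simp)
      have e0 : s 0 0 = n := by rw [f1 0 (by simp)]; exact h1.1
      have hin := h1.frame f1 (by simp) (by simp)
      refine ⟨⟨⟨hin.of_eq (by simp [RamMem.store_apply]) (by simp [RamMem.store_apply]),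
        by simpa [RamMem.store_apply, e3, e5] using h2⟩, fun i hi => ?_⟩,
        by simpa [RamMem.store_apply, e10] using h4⟩
      have hr := keyRank_lt (s₀ 3) (show i < n by omega)
      have hr' := keyRank_lt (s₀ 3) hj
      have hne : i ≠ j → keyRank n (s₀ 3) i ≠ keyRank n (s₀ 3) j :=
        fun hij h => hij (h2.keyRank_inj (by omega) hj h)
      have h3' := h3 i
      simp only [RamMem.store_apply, RamExpr.eval, f2, f3, e3, e10, e0, h4, if_true,
        show (3 : ℕ) ≠ 4 by decide, if_false, Function.update_apply]
      grind

/-- The running time of the deterministic first part, with `B` an upper bound for `n + 1`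
and `g`. -/
def arrangeTime (B : ℕ) : ℕ :=
  1 + (1 + (1 + (B * (1 + 3) + 3)) +
    (1 + (B * (1 + (1 + (B * (20 * B + 30 + 3) + 3)) + 3) + 3 +
      (B * (1 + (1 + (1 + (B * (1 + (1 + 1) + 3) + 3)) + (1 + (1 + 1))) + 3) + 3))))

theorem arrange_triple (hn : n + 1 ≤ B) (hg : g ≤ B) (hL : RowsLaminar n g M) :
    arrange.Triple (HasInput n m g M)
      (fun s => Sorted n m g M (fun k => k < g) s ∧ ListsTwice n (s 3) (s 4)) (arrangeTime B) :=
  (initKeys_triple (by omega)).seq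
    ((sortGroups_triple hn hg hL).seq (listAgents_triple (by omega)))

theorem advance_triple (hm : 0 < m) (hn : n ≤ B) {e : ℕ} (s₀ : RamMem) (hn₀ : s₀ 0 0 = n)
    (hm₀ : s₀ 0 1 = m) (h₀ : s₀ 13 0 * m + s₀ 14 0 = e * n) (hlt : s₀ 14 0 < m) :
    advance.Triple (fun s => s = s₀)
      (fun s => Frame [10, 13, 14] s₀ s ∧ s 13 0 * m + s 14 0 = (e + 1) * n ∧ s 14 0 < m)
      (1 + (1 + (B * (1 + (1 + (1 + 1) + 1) + 3) + 3))) := by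
  refine Triple.seq (Mid := fun s => Frame [10, 13, 14] s₀ s ∧
    s 13 0 * m + s 14 0 = (e + 1) * n ∧ s 14 0 < m + (n - 0)) (triple_write ?_) ?_
  · rintro s rfl
    refine ⟨(Frame.refl _ _).store (by simp) _ _, ?_, ?_⟩
    · simp [RamMem.store_apply, RamExpr.eval, hn₀, add_one_mul, ← h₀, add_assoc]
    · simp [RamMem.store_apply, RamExpr.eval, hn₀, hlt]
  · refine (Triple.forLoop (fun j s => Frame [10, 13, 14] s₀ s ∧
      s 13 0 * m + s 14 0 = (e + 1) * n ∧ s 14 0 < m + (n - j)) hn ?_ ?_ ?_).mono (fun s => id)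
      (fun s hs => by simpa using hs) le_rfl
    · rintro j s ⟨h1, -⟩
      simp [RamExpr.eval, h1 0 (by simp), hn₀]
    · rintro j s x ⟨h1, h2⟩
      exact ⟨h1.store (by simp) _ _, by simpa [RamMem.store_apply] using h2⟩
    · intro j hj
      refine Triple.ite (Triple.seq (Mid := fun s => (Frame [10, 13, 14] s₀ s ∧
        (s 13 0 + 1) * m + s 14 0 = (e + 1) * n ∧ s 14 0 < m + (n - (j + 1))) ∧ s 10 0 = j)
        (triple_write ?_) (triple_write ?_)) (triple_skip ?_)
      · rintro s ⟨⟨⟨h1, h2, h3⟩, h4⟩, h5⟩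
        simp only [RamExpr.eval, h1 0 (by simp), hm₀] at h5
        refine ⟨⟨h1.store (by simp) _ _, ?_, ?_⟩, by simpa [RamMem.store_apply] using h4⟩
        · simp only [RamMem.store_apply, RamExpr.eval, h1 0 (by simp), hm₀]
          simp only [show (13 : ℕ) ≠ 14 by decide, if_false, if_true, Function.update_self,
            add_one_mul (s 13 0)]
          omega
        · simp only [RamMem.store_apply, RamExpr.eval, h1 0 (by simp), hm₀, if_true,
            Function.update_self]
          omega
      · rintro s ⟨⟨h1, h2, h3⟩, h4⟩
        refine ⟨⟨h1.store (by simp) _ _, ?_, ?_⟩, by simpa [RamMem.store_apply] using h4⟩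
        · simpa [RamMem.store_apply, RamExpr.eval] using h2
        · simpa [RamMem.store_apply] using h3
      · rintro s ⟨⟨⟨h1, h2, h3⟩, h4⟩, h5⟩
        simp only [RamExpr.eval, h1 0 (by simp), hm₀] at h5
        exact ⟨⟨h1, h2, by omega⟩, h4⟩

/-- The running time of the deterministic last part, with `B` an upper bound for `n` and `m`. -/
def distributeTime (B : ℕ) : ℕ :=
  1 + (1 + (1 + (1 + (B * (1 + (1 + (1 + (1 + (B * (1 + (1 + (1 + 1) + 1) + 3) + 3)))) + 3) + 3))))

theorem distribute_triple (hm : 0 < m) (hn : n ≤ B) (hmB : m ≤ B) (s₀ : RamMem) (hn₀ : s₀ 0 0 = n)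
    (hm₀ : s₀ 0 1 = m) :
    distribute.Triple (fun s => s = s₀)
      (fun s => ∀ e < m, s 2 e = s₀ 4 (s₀ 12 0 + e * n / m)) (distributeTime B) := by
  refine Triple.seq (Mid := fun s => Frame [2, 10, 13, 14, 15] s₀ s ∧ s 13 0 = 0)
    (triple_write ?_) (Triple.seq (Mid := fun s => Frame [2, 10, 13, 14, 15] s₀ s ∧ s 13 0 = 0 ∧
      s 14 0 = 0) (triple_write ?_) ?_)
  · rintro s rfl
    exact ⟨(Frame.refl _ _).store (by simp) _ _, by simp [RamMem.store_apply, RamExpr.eval]⟩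
  · rintro s ⟨h1, h2⟩
    exact ⟨h1.store (by simp) _ _, by simpa [RamMem.store_apply, RamExpr.eval] using h2⟩
  · refine (Triple.forLoop (fun e s => Frame [2, 10, 13, 14, 15] s₀ s ∧
      s 13 0 * m + s 14 0 = e * n ∧ s 14 0 < m ∧
      ∀ e' < e, s 2 e' = s₀ 4 (s₀ 12 0 + e' * n / m)) hmB ?_ ?_ ?_).mono
      (fun s hs => ⟨hs.1, by simp [hs.2], by simp [hs.2, hm], by simp⟩) (fun s hs => hs.2.2.2) le_rfl
    · rintro j s ⟨h1, -⟩
      simp [RamExpr.eval, h1 0 (by simp), hm₀]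
    · rintro j s x ⟨h1, h2⟩
      exact ⟨h1.store (by simp) _ _, by simpa [RamMem.store_apply] using h2⟩
    · intro e he
      refine Triple.seq (Mid := fun s => (Frame [2, 10, 13, 14, 15] s₀ s ∧
        s 13 0 * m + s 14 0 = e * n ∧ s 14 0 < m ∧
        ∀ e' < e + 1, s 2 e' = s₀ 4 (s₀ 12 0 + e' * n / m)) ∧ s 15 0 = e) (triple_write ?_) ?_
      · rintro s ⟨⟨h1, h2, h3, h4⟩, h5⟩
        refine ⟨⟨h1.store (by simp) _ _, by simpa [RamMem.store_apply] using h2,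
          by simpa [RamMem.store_apply] using h3, fun e' he' => ?_⟩,
          by simpa [RamMem.store_apply] using h5⟩
        have hq : e * n / m = s 13 0 := by
          rw [← h2, mul_comm, Nat.mul_add_div hm, Nat.div_eq_of_lt h3, add_zero]
        have h4' := h4 e'
        simp only [RamMem.store_apply, RamExpr.eval, h5, h1 4 (by simp), h1 12 (by simp), if_true,
          Function.update_apply, ← hq]
        grind
      · rintro s₁ ⟨⟨h1, h2, h3, h4⟩, h5⟩
        have e0 : s₁ 0 = s₀ 0 := h1 0 (by simp)
        refine (advance_triple hm hn s₁ (by rw [e0, hn₀]) (by rw [e0, hm₀]) h2 h3).mono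
          (Pre' := fun s => s = s₁) (fun s => id) ?_ le_rfl s₁ rfl
        rintro s ⟨f1, f2, f3⟩
        refine ⟨⟨fun a ha => ?_, f2, f3, ?_⟩, by rw [f1 15 (by simp), h5]⟩
        · rw [f1 a, h1 a ha]
          simp only [List.mem_cons, not_or] at ha ⊢; tauto
        · rw [f1 2 (by simp)]; exact h4

end ChoresProgram

/-! ### Shares under uniform valuations -/

namespace ChoresInstance

variable {n m : ℕ} {I : ChoresInstance n m}

theorem Uniform.cost_eq (hu : I.Uniform) (A : ChoresAllocation n m) (G : Finset (Fin n)) :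
    I.cost A G = ((Finset.univ.filter fun e => A e ∈ G).card : ℝ) := by
  have h : ∀ i ∈ G, (∑ e ∈ A.bundle i, I.v i e) = ((A.bundle i).card : ℝ) := fun i _ => by
    simp [hu i]
  rw [cost, Finset.sum_congr rfl h, Finset.card_eq_sum_card_fiberwise (f := A) (t := G)
    (fun e he => by simpa using he)]
  push_cast
  refine Finset.sum_congr rfl fun i hi => ?_
  rw [ChoresAllocation.bundle, Finset.filter_filter]
  congr 2
  ext e
  simp only [Finset.mem_filter, Finset.mem_univ, true_and]
  constructor
  · rintro rfl; exact ⟨hi, rfl⟩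
  · exact And.right

theorem Uniform.groupBundleVal_eq (hu : I.Uniform) {G : Finset (Fin n)} (hG : G.Nonempty)
    (B : Finset (Fin m)) : I.groupBundleVal G B = B.card := by
  have : Nonempty G := hG.to_subtype
  have h (e : Fin m) : I.groupVal G e = 1 := by
    simp [groupVal, show ∀ i, I.v i e = 1 from fun i => hu i e]
  simp [groupBundleVal, h]

theorem Uniform.PS_eq (hu : I.Uniform) (G : Finset (Fin n)) : I.PS G = (G.card : ℝ) / n * m := by
  rcases G.eq_empty_or_nonempty with rfl | hG
  · simp [PS]
  · rw [PS, hu.groupBundleVal_eq hG, Finset.card_univ, Fintype.card_fin]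

theorem groupBundleVal_nonneg (G : Finset (Fin n)) (B : Finset (Fin m)) :
    0 ≤ I.groupBundleVal G B :=
  Finset.sum_nonneg fun e _ => Real.iInf_nonneg fun i => I.v_nonneg i e

theorem APS_nonneg (G : Finset (Fin n)) : 0 ≤ I.APS G := by
  refine Real.sSup_nonneg ?_
  rintro _ ⟨p, -, rfl⟩
  refine Real.sInf_nonneg ?_
  rintro _ ⟨B, -, rfl⟩
  exact groupBundleVal_nonneg G B

theorem minBundleVal_le_APS (G : Finset (Fin n)) {p : Fin m → ℝ} (hp : p ∈ stdSimplex ℝ (Fin m)) :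
    I.minBundleVal G p ≤ I.APS G := by
  refine le_csSup ⟨I.groupBundleVal G Finset.univ, ?_⟩ ⟨p, hp, rfl⟩
  rintro _ ⟨q, hq, rfl⟩
  refine csInf_le ⟨0, ?_⟩ ⟨Finset.univ, ?_, rfl⟩
  · rintro _ ⟨B, -, rfl⟩
    exact groupBundleVal_nonneg G B
  · rw [hq.2]
    exact div_le_one_of_le₀ (by exact_mod_cast card_finset_fin_le G) (by positivity)

/-- A nonempty group can be assigned `⌈|G| * m / n⌉` chores without exceeding its anyprice share:
at equal prices, every bundle of price `|G| / n` is that large. -/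
theorem Uniform.le_APS (hu : I.Uniform) (hn : 0 < n) (hm : 0 < m) {G : Finset (Fin n)}
    (hG : G.Nonempty) {c : ℕ} (hc : c * n < G.card * m + n) : (c : ℝ) ≤ I.APS G := by
  have hm' : (0 : ℝ) < m := by exact_mod_cast hm
  have hn' : (0 : ℝ) < n := by exact_mod_cast hn
  have hp : (fun _ => (m : ℝ)⁻¹) ∈ stdSimplex ℝ (Fin m) :=
    ⟨fun _ => by positivity, by simp [hm'.ne']⟩
  refine le_trans ?_ (minBundleVal_le_APS G hp)
  refine le_csInf ⟨_, Finset.univ, ?_, rfl⟩ ?_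
  · rw [hp.2]
    exact div_le_one_of_le₀ (by exact_mod_cast card_finset_fin_le G) hn'.le
  · rintro _ ⟨B, hB, rfl⟩
    rw [hu.groupBundleVal_eq hG]
    rw [Finset.sum_const, nsmul_eq_mul, ← div_eq_mul_inv, div_le_div_iff₀ hn' hm'] at hB
    have hB' : G.card * m ≤ B.card * n := by exact_mod_cast hB
    have : c < B.card + 1 := by
      by_contra! h
      have := Nat.mul_le_mul_right n h
      rw [add_one_mul] at this
      omega
    exact_mod_cast Nat.le_of_lt_succ this

/-! ### Distributing the chores around the circle -/

/-- A finite set of integers that fits into an interval of length `K / n` has fewer than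
`K / n + 1` elements. -/
theorem card_mul_lt_of_sub_mul_lt {T : Finset ℤ} {n K : ℤ} (hn : 0 < n) (hK : 0 ≤ K)
    (h : ∀ x ∈ T, ∀ y ∈ T, (x - y) * n < K) : T.card * n < K + n := by
  rcases T.eq_empty_or_nonempty with rfl | hT
  · simp; omega
  · have hsub : T ⊆ Finset.Icc (T.min' hT) (T.max' hT) := fun x hx =>
      Finset.mem_Icc.2 ⟨T.min'_le x hx, T.le_max' x hx⟩
    have hcard := Finset.card_le_card hsub
    have hle : T.min' hT ≤ T.max' hT := T.min'_le_max' hT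
    rw [Int.card_Icc] at hcard
    have h1 := h _ (T.max'_mem hT) _ (T.min'_mem hT)
    have h2 : (T.card : ℤ) ≤ T.max' hT - T.min' hT + 1 := by omega
    have h3 := mul_le_mul_of_nonneg_right h2 hn.le
    linarith

/-- If chore `e` goes to position `x + ⌊e * n / m⌋` modulo `n`, then a set of agents whose
positions differ by less than `L` receives fewer than `L * m / n + 1` chores. -/
theorem card_filter_mem_mul_lt (hn : 0 < n) (hm : 0 < m) {A : ChoresAllocation n m}
    {G : Finset (Fin n)} {pos : Fin n → ℕ} {x L : ℕ}
    (hA : ∀ e, ∃ t, pos (A e) + n * t = x + e * n / m)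
    (hpos : ∀ i ∈ G, ∀ j ∈ G, pos i < pos j + L) :
    (Finset.univ.filter fun e => A e ∈ G).card * n < L * m + n := by
  choose t ht using hA
  -- unrolling the circle: chore `e` is moved `t e` turns back, so that its position is exact
  let f : Fin m → ℤ := fun e => (e : ℤ) - m * t e
  have hf : Function.Injective f := fun e e' h => by
    have h1 : (e : ℤ) % m = (e' : ℤ) % m := by
      rw [← Int.sub_mul_emod_self_left (e : ℤ) m (t e),
        ← Int.sub_mul_emod_self_left (e' : ℤ) m (t e')]
      exact congrArg (· % (m : ℤ)) h
    rw [Int.emod_eq_of_lt (by omega) (by omega), Int.emod_eq_of_lt (by omega) (by omega)] at h1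
    exact Fin.ext (by exact_mod_cast h1)
  have hT := card_mul_lt_of_sub_mul_lt (T := (Finset.univ.filter fun e => A e ∈ G).map ⟨f, hf⟩)
    (n := n) (K := L * m) (by omega) (by positivity) ?_
  · rw [Finset.card_map] at hT
    exact_mod_cast hT
  · simp only [Finset.mem_map, Finset.mem_filter, Finset.mem_univ, true_and,
      Function.Embedding.coeFn_mk]
    rintro _ ⟨e, he, rfl⟩ _ ⟨e', he', rfl⟩
    have h1 : (e * n : ℤ) < m * ((e * n / m : ℕ) + 1 : ℤ) := by
      exact_mod_cast Nat.lt_mul_div_succ (e * n : ℕ) hm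
    have h2 : (m * (e' * n / m : ℕ) : ℤ) ≤ e' * n := by exact_mod_cast Nat.mul_div_le (e' * n) m
    have h3 : ((e * n / m : ℕ) : ℤ) = pos (A e) + n * t e - x := by have := ht e; omega
    have h4 : ((e' * n / m : ℕ) : ℤ) = pos (A e') + n * t e' - x := by have := ht e'; omega
    have h5 : (pos (A e) : ℤ) + 1 - pos (A e') ≤ L := by have := hpos _ he _ he'; omega
    have h6 := mul_le_mul_of_nonneg_left h5 (Int.natCast_nonneg m)
    rw [h3] at h1
    rw [h4] at h2
    simp only [f]
    linarith

/-- If the starting position runs through all positions, every chore visits every agent once, so a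
group `G` receives `|G| * m` chores in total. -/
theorem sum_card_filter_mem {A : Fin n → ChoresAllocation n m} {pos : Fin n → ℕ} {q : Fin m → ℕ}
    (hA : ∀ x e, ∃ t, pos (A x e) + n * t = x + q e) (G : Finset (Fin n)) :
    ∑ x, (Finset.univ.filter fun e => A x e ∈ G).card = G.card * m := by
  have hcard (e : Fin m) : (Finset.univ.filter fun x => A x e ∈ G).card = G.card := by
    have hinj : Function.Injective fun x => A x e := fun x y hxy => by
      obtain ⟨t, ht⟩ := hA x e
      obtain ⟨t', ht'⟩ := hA y e
      have hxy' : A x e = A y e := hxy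
      rw [hxy'] at ht
      have hmod : (x + q e : ℕ) ≡ y + q e [MOD n] := by
        rw [← ht, ← ht', Nat.ModEq, Nat.add_mul_mod_self_left, Nat.add_mul_mod_self_left]
      exact Fin.ext ((Nat.ModEq.add_right_cancel' _ hmod).eq_of_lt_of_lt x.2 y.2)
    let σ := Equiv.ofBijective _ (Finite.injective_iff_bijective.1 hinj)
    rw [← Finset.card_map σ.toEmbedding]
    congr 1
    ext i
    have hi : A (σ.symm i) e = i := σ.apply_symm_apply i
    simp [Finset.mem_map_equiv, hi]
  simp only [Finset.card_filter]
  rw [Finset.sum_comm]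
  simp only [← Finset.card_filter, hcard]
  simp [mul_comm]

/-- The expected cost of a group under a uniformly chosen allocation is the average cost. -/
theorem expectedCost_map_uniform {N : ℕ} [NeZero N] (A : Fin N → ChoresAllocation n m)
    (G : Finset (Fin n)) :
    I.expectedCost ((PMF.uniformOfFintype (Fin N)).map fun x => some (A x)) G =
      (∑ x, I.cost (A x) G) / N := by
  have h (B : ChoresAllocation n m) :
      (((PMF.uniformOfFintype (Fin N)).map fun x => some (A x)) (some B)).toReal =
        ∑ x, if B = A x then (N : ℝ)⁻¹ else 0 := by
    rw [PMF.map_apply, tsum_fintype, ENNReal.toReal_sum]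
    · refine Finset.sum_congr rfl fun x _ => ?_
      simp only [Option.some.injEq]
      split_ifs <;> simp
    · intro x _
      split_ifs <;> simp [NeZero.ne N]
  simp only [expectedCost, h, Finset.sum_mul]
  rw [Finset.sum_comm, Finset.sum_div]
  refine Finset.sum_congr rfl fun x _ => ?_
  simp [ite_mul, div_eq_inv_mul]

/-! ### Correctness of the program -/

open ChoresProgram RamProg

theorem input_table (k : Fin I.g) (i : Fin n) :
    I.input 1 (k * n + i) ≠ 0 ↔ i ∈ I.group k := by
  simp only [input, ne_eq, ite_eq_right_iff, one_ne_zero, imp_false, not_not]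
  constructor
  · rintro ⟨k', i', h, hi⟩
    have hn : 0 < n := i.pos
    have hk : (k : ℕ) = k' := by
      have := congrArg (· / n) h
      simpa [mul_comm _ n, Nat.mul_add_div hn, Nat.div_eq_of_lt] using this
    obtain rfl := Fin.ext hk
    obtain rfl : i = i' := Fin.ext (by omega)
    exact hi
  · exact fun h => ⟨k, i, rfl, h⟩

theorem rowSize_input (k : Fin I.g) : rowSize n (I.input 1) k = (I.group k).card := by
  rw [← Finset.card_map Fin.valEmbedding, rowSize]
  congr 1
  ext i
  simp only [Finset.mem_filter, Finset.mem_range, Finset.mem_map, Fin.valEmbedding_apply]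
  constructor
  · rintro ⟨hi, h⟩
    exact ⟨⟨i, hi⟩, (input_table k ⟨i, hi⟩).1 h, rfl⟩
  · rintro ⟨i, hi, rfl⟩
    exact ⟨i.2, (input_table k i).2 hi⟩

theorem Laminar.rowsLaminar (hL : I.Laminar) : RowsLaminar n I.g (I.input 1) := by
  intro k hk l hl hkl
  have hk' := fun i : Fin n => input_table (I := I) ⟨k, hk⟩ i
  have hl' := fun i : Fin n => input_table (I := I) ⟨l, hl⟩ i
  have hkl' : (I.group ⟨k, hk⟩).card ≤ (I.group ⟨l, hl⟩).card := by
    simpa only [← rowSize_input] using hkl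
  rcases hL ⟨k, hk⟩ ⟨l, hl⟩ with h | h | h
  · refine Or.inl fun i hi hik => ?_
    by_contra hil
    exact Finset.disjoint_left.1 h ((hk' ⟨i, hi⟩).1 hik) ((hl' ⟨i, hi⟩).1 hil)
  · exact Or.inr fun i hi hik => (hl' ⟨i, hi⟩).2 (h ((hk' ⟨i, hi⟩).1 hik))
  · rw [← Finset.eq_of_subset_of_card_le h hkl'] at hk'
    exact Or.inr fun i hi hik => (hl' ⟨i, hi⟩).2 ((hk' ⟨i, hi⟩).1 hik)

/-- The output of the program: for a fixed cyclic order of the agents, in which agent `i` has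
position `pos i` and every group is contiguous, the program starts at a uniformly random position
`x` and gives chore `e` to the agent `⌊e * n / m⌋` positions further. -/
theorem outputDist_program (hn : 0 < n) (hm : 0 < m) (hL : I.Laminar) :
    ∃ (A : Fin (n - 1 + 1) → ChoresAllocation n m) (pos : Fin n → ℕ),
      I.outputDist program (arrangeTime (n + m + I.g + 1) + distributeTime (n + m + I.g + 1) + 3) =
        (PMF.uniformOfFintype (Fin (n - 1 + 1))).map (fun x => some (A x)) ∧
      (∀ x e, ∃ t, pos (A x e) + n * t = x + e * n / m) ∧
      ∀ k, ∀ i ∈ I.group k, ∀ j ∈ I.group k, pos i < pos j + (I.group k).card := by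
  obtain ⟨s₁, t₁, ht₁, hr₁, ⟨hin, hord⟩, hlist⟩ :=
    arrange_triple (n := n) (m := m) (g := I.g) (B := n + m + I.g + 1) (M := I.input 1)
      (by omega) (by omega) hL.rowsLaminar I.input ⟨rfl, rfl, rfl, rfl⟩
  have hdist (x : Fin (n - 1 + 1)) := distribute_triple hm (B := n + m + I.g + 1) (n := n) (by omega)
    (by omega) (s₁.store 12 0 x) (by simpa [RamMem.store_apply] using hin.1)
    (by simpa [RamMem.store_apply] using hin.2.1) _ rfl
  choose f u hu hr hf using hdist
  simp only [RamMem.store_apply, if_true, Function.update_self,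
    show (4 : ℕ) ≠ 12 by decide, if_false] at hf
  have hspec (x : Fin (n - 1 + 1)) (e : Fin m) :
      s₁ 4 (x + e * n / m) < n ∧
        ∃ t, keyRank n (s₁ 3) (s₁ 4 (x + e * n / m)) + n * t = x + e * n / m := by
    refine hlist.spec hord ?_
    have : e * n / m < n := by
      rw [Nat.div_lt_iff_lt_mul hm, mul_comm]
      exact Nat.mul_lt_mul_of_pos_left e.2 hn
    omega
  refine ⟨fun x e => ⟨_, (hspec x e).1⟩, fun i => keyRank n (s₁ 3) i, ?_, fun x e => (hspec x e).2,
    fun k i hi j hj => ?_⟩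
  · rw [outputDist, program, run_seq_draw_seq hr₁ ht₁ (k := n - 1)
      (by simp [RamExpr.eval, hin.1]) f fun x => ⟨u x, hu x, hr x⟩, PMF.map_comp]
    congr 1
    funext x
    have hout : ∀ e : Fin m, f x 2 e = s₁ 4 (x + e * n / m) := fun e => hf x e e.2
    simp only [Function.comp_apply, output, hout]
    rw [dif_pos ⟨rfl, fun e => (hspec x e).1⟩]
  · rw [← rowSize_input]
    exact hord.keyRank_sub_lt k.2 i.2 j.2 ((input_table k i).2 hi) ((input_table k j).2 hj)

theorem program_correct (hn : 0 < n) (hm : 0 < m) (hu : I.Uniform) (hL : I.Laminar) :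
    let μ := I.outputDist program
      (arrangeTime (n + m + I.g + 1) + distributeTime (n + m + I.g + 1) + 3)
    (∀ o ∈ μ.support, ∃ A : ChoresAllocation n m, o = some A ∧
      ∀ k : Fin I.g, I.cost A (I.group k) ≤ I.APS (I.group k)) ∧
    ∀ k : Fin I.g, I.expectedCost μ (I.group k) ≤ I.PS (I.group k) := by
  intro μ
  obtain ⟨A, pos, hμ, hA, hpos⟩ := outputDist_program hn hm hL
  change μ = _ at hμ
  rw [hμ]
  refine ⟨fun o ho => ?_, fun k => ?_⟩
  · obtain ⟨x, -, rfl⟩ := (PMF.mem_support_map_iff _ _ _).1 ho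
    refine ⟨A x, rfl, fun k => ?_⟩
    rw [hu.cost_eq]
    rcases (I.group k).eq_empty_or_nonempty with hG | hG
    · simpa [hG] using APS_nonneg (I := I) ∅
    · exact hu.le_APS hn hm hG (card_filter_mem_mul_lt hn hm (hA x) (hpos k))
  · have hN : n - 1 + 1 = n := by omega
    have hsum : ∑ x, (Finset.univ.filter fun e => A x e ∈ I.group k).card =
        (I.group k).card * m := by
      rw [← sum_card_filter_mem (A := fun x => A (x.cast hN.symm)) (fun x e => hA _ e)]
      exact (Equiv.sum_comp (finCongr hN.symm) _).symm
    rw [expectedCost_map_uniform, hu.PS_eq]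
    simp only [hu.cost_eq]
    rw [← Nat.cast_sum, hsum, hN, Nat.cast_mul, div_mul_eq_mul_div]

end ChoresInstance

theorem mainTheorem12 :
    (∀ (n m : ℕ) (I : ChoresInstance n m), 0 < n → 0 < m → I.Uniform → I.Laminar →
      ∃ A : ChoresAllocation n m, ∀ k : Fin I.g, I.cost A (I.group k) ≤ I.APS (I.group k)) ∧
    (∃ (P : RamProg) (q : Polynomial ℕ),
      ∀ (n m : ℕ) (I : ChoresInstance n m), 0 < n → 0 < m → I.Uniform → I.Laminar →
        (∀ o ∈ (I.outputDist P (q.eval (n + m + I.g))).support,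
          ∃ A : ChoresAllocation n m, o = some A ∧
            ∀ k : Fin I.g, I.cost A (I.group k) ≤ I.APS (I.group k)) ∧
        (∀ k : Fin I.g,
          I.expectedCost (I.outputDist P (q.eval (n + m + I.g))) (I.group k)
            ≤ I.PS (I.group k))) := by
  refine ⟨fun n m I hn hm hu hL => ?_, ChoresProgram.program, ?_⟩
  · obtain ⟨o, ho⟩ := PMF.support_nonempty (I.outputDist ChoresProgram.program _)
    obtain ⟨A, -, hA⟩ := (ChoresInstance.program_correct hn hm hu hL).1 o ho
    exact ⟨A, hA⟩
  · obtain ⟨q, hq⟩ : ∃ q : Polynomial ℕ, ∀ N, q.eval N =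
        ChoresProgram.arrangeTime (N + 1) + ChoresProgram.distributeTime (N + 1) + 3 := by
      let X : Polynomial ℕ := Polynomial.X + 1
      refine ⟨1 + (1 + (1 + (X * (1 + 3) + 3)) +
        (1 + (X * (1 + (1 + (X * (20 * X + 30 + 3) + 3)) + 3) + 3 +
        (X * (1 + (1 + (1 + (X * (1 + (1 + 1) + 3) + 3)) + (1 + (1 + 1))) + 3) + 3)))) +
        (1 + (1 + (1 + (1 + (X * (1 + (1 + (1 + (1 + (X * (1 + (1 + (1 + 1) + 1) + 3) + 3)))) + 3)
        + 3))))) + 3, fun N => ?_⟩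
      simp [X, ChoresProgram.arrangeTime, ChoresProgram.distributeTime]
    refine ⟨q, fun n m I hn hm hu hL => ?_⟩
    rw [hq]
    exact ChoresInstance.program_correct hn hm hu hL
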